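/- Let $d<D$ be positive integers, let $\alpha>0$, and put $s=\lceil(1+\alpha)(d+1)\rceil$ and $\Delta=s^2$. Let $m,n$ be positive integers with $n=\lfloor m^{\alpha}\rfloor$ that are sufficiently large with respect to $D$ and $\alpha$. Then there exist a prime $p$, a set $\mathcal{P}\subseteq\mathbb{F}_p^D$ of $m$ points, and a set $\mathcal{V}$ of $n$ distinct varieties in $D$-dimensional affine space, each defined by polynomials over $\mathbb{F}_p$, irreducible over $\overline{\mathbb{F}}_p$, of dimension $d$ and of degree at most $\Delta$, such that the incidence graph $G(\mathcal{P},\mathcal{V})$ contains no copy of $K_{s,s}$ (note $s=\Delta^{1/2}$), and the number of incidences satisfies $$I(\mathcal{P},\mathcal{V})\ \ge\ c\, m^{\frac{d}{d+1}}\, n ,$$ where $c>0$ depends only on $d$ and $\alpha$. Here a variety is a nonempty irreducible algebraic subset of $\overline{\mathbb{F}}_p^D$; its dimension is the degree of the Hilbert polynomial of its projective closure, and its degree is $(\dim V)!$ times the leading coefficient of that polynomial. The incidence graph $G(\mathcal{P},\mathcal{V})$ is the bipartite graph with parts $\mathcal{P}$ and $\mathcal{V}$ in which $x\in\mathcal{P}$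 and $V\in\mathcal{V}$ are joined if $x\in V$ (with $\mathbb{F}_p^D\subseteq\overline{\mathbb{F}}_p^D$), and $I(\mathcal{P},\mathcal{V})$ is its number of edges. -/

import Mathlib

open scoped LinearAlgebra.Projectivization

noncomputable section

namespace PointVariety

/-! ### Affine algebraic sets and varieties -/

/-- `V ⊆ K^D` is the set of common zeros in `K^D` of finitely many polynomials with coefficients in
the subfield `F`. -/
def IsAlgebraicSet (F : Type*) {K : Type*} [Field F] [Field K] [Algebra F K] {D : ℕ}
    (V : Set (Fin D → K)) : Prop :=
  ∃ S : Finset (MvPolynomial (Fin D) F), V = {a | ∀ f ∈ S, MvPolynomial.aeval a f = 0}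

/-- An (affine) variety in `K^D`: a nonempty algebraic set that is not the union of two algebraic
sets properly contained in it.  It is used below for `K` algebraically closed. -/
structure IsVariety {K : Type*} [Field K] {D : ℕ} (V : Set (Fin D → K)) : Prop where
  algebraic : IsAlgebraicSet K V
  nonempty : V.Nonempty
  irreducible : ∀ V₁ V₂ : Set (Fin D → K), IsAlgebraicSet K V₁ → IsAlgebraicSet K V₂ →
    V₁ ⊂ V → V₂ ⊂ V → V₁ ∪ V₂ ≠ V

/-! ### Projective closure, Hilbert polynomial, dimension and degree -/

/-- The standard embedding `a ↦ [1 : a_1 : … : a_D]` of affine into projective space. -/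
def toProj {K : Type*} [Field K] {D : ℕ} (a : Fin D → K) : ℙ K (Fin (D + 1) → K) :=
  Projectivization.mk K (Fin.cons 1 a) (fun h => one_ne_zero (congrFun h 0 : (1 : K) = 0))

/-- The homogeneous polynomials of degree `t` in `D + 1` variables that vanish on a set `W` of
points of projective space.  By homogeneity the choice of the representative is irrelevant. -/
def idealPart {K : Type*} [Field K] {D : ℕ} (W : Set (ℙ K (Fin (D + 1) → K))) (t : ℕ) :
    Submodule K (MvPolynomial.homogeneousSubmodule (Fin (D + 1)) K t) where
  carrier := {f | ∀ x ∈ W, MvPolynomial.eval x.rep f.1 = 0}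
  zero_mem' := by simp
  add_mem' := by
    intro f g hf hg x hx
    simp [hf x hx, hg x hx]
  smul_mem' := by
    intro c f hf x hx
    simp [hf x hx]

/-- The projective closure of an affine set: the smallest projective algebraic set containing it,
i.e. the common zeros of all homogeneous polynomials that vanish on it. -/
def projClosure {K : Type*} [Field K] {D : ℕ} (V : Set (Fin D → K)) :
    Set (ℙ K (Fin (D + 1) → K)) :=
  {x | ∀ t : ℕ, ∀ f ∈ idealPart (toProj '' V) t, MvPolynomial.eval x.rep f.1 = 0}

/-- The Hilbert function of a projective algebraic set. -/
def hilbertFunction {K : Type*} [Field K] {D : ℕ} (W : Set (ℙ K (Fin (D + 1) → K)))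
    (t : ℕ) : ℕ :=
  Module.finrank K (MvPolynomial.homogeneousSubmodule (Fin (D + 1)) K t ⧸ idealPart W t)

/-- `P` is the Hilbert polynomial of `W`. -/
def IsHilbertPolynomial {K : Type*} [Field K] {D : ℕ} (W : Set (ℙ K (Fin (D + 1) → K)))
    (P : Polynomial ℚ) : Prop :=
  ∀ᶠ t : ℕ in Filter.atTop, (hilbertFunction W t : ℚ) = P.eval (t : ℚ)

/-- The affine variety `V` has dimension `d`: the Hilbert polynomial of its projective closure has
degree `d` (in particular it is not zero). -/
def HasDimension {K : Type*} [Field K] {D : ℕ} (V : Set (Fin D → K)) (d : ℕ) : Prop :=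
  ∃ P : Polynomial ℚ, IsHilbertPolynomial (projClosure V) P ∧ P.degree = (d : WithBot ℕ)

/-- The affine variety `V` has degree `e`: the Hilbert polynomial of its projective closure has
leading coefficient `e / (dim V)!`. -/
def HasDegree {K : Type*} [Field K] {D : ℕ} (V : Set (Fin D → K)) (e : ℕ) : Prop :=
  ∃ P : Polynomial ℚ, IsHilbertPolynomial (projClosure V) P ∧
    (e : ℚ) = (P.natDegree.factorial : ℚ) * P.leadingCoeff

/-! ### Incidence graphs -/

/-- The incidence graph of a set of points of `F^D` and a set of subsets of `K^D`, where `F^D` is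
regarded as a subset of `K^D`. -/
def incidenceGraph {F K : Type*} [Field F] [Field K] [Algebra F K] {D : ℕ}
    (Pts : Finset (Fin D → F)) (Vars : Finset (Set (Fin D → K))) : SimpleGraph (Pts ⊕ Vars) where
  Adj
    | Sum.inl x, Sum.inr V => (fun i => algebraMap F K (x.1 i)) ∈ V.1
    | Sum.inr V, Sum.inl x => (fun i => algebraMap F K (x.1 i)) ∈ V.1
    | _, _ => False
  symm := ⟨by rintro (x | V) (y | W) h <;> exact h⟩
  loopless := ⟨by rintro (x | V) h <;> exact h⟩

/-- The number of incidences: the number of edges of the incidence graph. -/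
def incidences {F K : Type*} [Field F] [Field K] [Algebra F K] {D : ℕ}
    (Pts : Finset (Fin D → F)) (Vars : Finset (Set (Fin D → K))) : ℕ :=
  (incidenceGraph Pts Vars).edgeSet.ncard

end PointVariety

end

/-!
The varieties are graphs. Take a prime `p` of order `m^{1/(d+1)}` and, for polynomials `f` in `d`
variables over `F_p` of degree at most `Δ`, consider the graph `y = f(x)` in the first `d + 1`
coordinates of affine `D`-space, the remaining coordinates being zero.

*Geometry.* A graph is parametrized by affine `d`-space over an infinite field, so it is
irreducible (`isVariety_graphVariety`). A homogeneous polynomial of degree `t` vanishes on its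
projective closure iff its dehomogenization is killed by `y ↦ f`, and the kernel of that
substitution is generated by `y - f`. The Hilbert function at `t` is therefore the number of
monomials in `d + 1` variables of degree in `(t - e, t]`, where `e = deg (y - f)`, and for large `t`
this is `∑_{j < e} C(t - j + d, d)` (`isHilbertPolynomial_graphVariety`): the dimension is `d` and
the degree is `e ≤ Δ`.

*Incidences.* The point set contains `A × F_p` with `|A| = ⌊m / p⌋`. Every graph contains exactly
one point above each element of `A`, whence at least `⌊m / p⌋ n` incidences, which has the order
`m^{d/(d+1)} n`.

*No `K_{s,s}`.* Choose `n` polynomials independently and uniformly. A graph never contains two points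
with the same `x`, and by interpolation (`card_filter_eval_eq_mul`) it contains `s` given points with
distinct `x` with probability `p^{-s}`. So the expected number of ordered copies of `K_{s,s}` is at
most `m^s n^s p^{-s²}`, which is at most `1/4` because `m n ≤ (m^{1/(d+1)})^s` by the choice of `s`
and `p ≥ 4 m^{1/(d+1)}`. Two of the polynomials coincide with probability at most `n² p^{-2s} ≤ 1/4`.
Some choice avoids both events (`exists_injective_family_without_biclique`).
-/

open MvPolynomial

namespace PointVariety

/-! ### Polynomials of bounded total degree -/

lemma eval_aeval {R : Type*} [CommRing R] {σ τ : Type*} (x : τ → R)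
    (v : σ → MvPolynomial τ R) (g : MvPolynomial σ R) :
    eval x (aeval v g) = eval (fun i => eval x (v i)) g := by
  simp only [← aeval_eq_eval]
  exact congrArg (fun φ : MvPolynomial σ R →ₐ[R] R => φ g) (comp_aeval v (aeval x))

lemma eval_smul_of_isHomogeneous {K : Type*} [Field K] {σ : Type*} {g : MvPolynomial σ K} {t : ℕ}
    (hg : g.IsHomogeneous t) (c : K) (x : σ → K) : eval (c • x) g = c ^ t * eval x g := by
  rw [eval_eq, eval_eq, Finset.mul_sum]
  refine Finset.sum_congr rfl fun m hm => ?_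
  have hm' : m.degree = t := by
    by_contra h
    exact (mem_support_iff.1 hm) (hg.coeff_eq_zero h)
  simp only [Pi.smul_apply, smul_eq_mul, mul_pow, Finset.prod_mul_distrib]
  rw [Finset.prod_pow_eq_pow_sum, ← hm', Finsupp.degree_apply]
  ring

/-- Substituting polynomials of degree at most one does not raise the total degree. -/
lemma totalDegree_aeval_le {K : Type*} [Field K] {σ τ : Type*} {v : σ → MvPolynomial τ K}
    (hv : ∀ i, (v i).totalDegree ≤ 1) (g : MvPolynomial σ K) :
    (aeval v g).totalDegree ≤ g.totalDegree := by
  rw [g.as_sum, map_sum, ← g.as_sum]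
  refine totalDegree_finsetSum_le fun m hm => ?_
  rw [aeval_monomial, algebraMap_eq]
  refine (totalDegree_mul _ _).trans ?_
  rw [totalDegree_C, zero_add]
  refine (totalDegree_finsetProd _ _).trans (le_trans ?_ (le_totalDegree hm))
  refine Finset.sum_le_sum fun i _ => (totalDegree_pow _ _).trans ?_
  exact (Nat.mul_le_mul_left _ (hv i)).trans (mul_one _).le

lemma totalDegree_map_le {R S : Type*} [CommSemiring R] [CommSemiring S] {σ : Type*} (φ : R →+* S)
    (f : MvPolynomial σ R) : (map φ f).totalDegree ≤ f.totalDegree :=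
  Finset.sup_mono (support_map_subset φ f)

/-- The space of polynomials of total degree at most `t` in `r + 1` variables has dimension
`∑_{k ≤ t} C(k + r, r)`: count the monomials degree by degree. -/
lemma finrank_restrictTotalDegree (K : Type*) [Field K] {σ : Type*} [Fintype σ] {r : ℕ}
    (hσ : Fintype.card σ = r + 1) (t : ℕ) :
    Module.finrank K (restrictTotalDegree σ K t) =
      ∑ k ∈ Finset.range (t + 1), (k + r).choose r := by
  classical
  have hset : {n : σ →₀ ℕ | (n.sum fun _ e => e) ≤ t} =
      ((Finset.range (t + 1)).biUnion fun k =>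
        (Finset.univ : Finset σ).finsuppAntidiag k : Finset (σ →₀ ℕ)) := by
    ext n
    have : (n.sum fun _ e => e) = ∑ i, n i := Finsupp.sum_fintype _ _ fun _ => rfl
    simp [Finset.mem_finsuppAntidiag, this]
  have hfin : Module.finrank K (restrictTotalDegree σ K t) =
      Nat.card {n : σ →₀ ℕ | (n.sum fun _ e => e) ≤ t} :=
    Module.finrank_eq_nat_card_basis (basisRestrictSupport K _)
  rw [hfin, hset, Nat.card_coe_set_eq, Set.ncard_coe_finset, Finset.card_biUnion]
  · refine Finset.sum_congr rfl fun k _ => ?_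
    rw [Finset.card_finsuppAntidiag_nat_eq_choose, Finset.card_univ, hσ]
    rw [show r + 1 + k - 1 = k + r by omega]
    exact Nat.choose_symm_add
  · intro i _ j _ hij
    rw [Function.onFun, Finset.disjoint_left]
    intro n hn hn'
    rw [Finset.mem_finsuppAntidiag] at hn hn'
    exact hij (hn.1.symm.trans hn'.1)

/-! ### The substitution of a polynomial for a variable -/

/-- The substitution homomorphism `K[x₁, …, x_d, y] → K[x₁, …, x_d]`, `y ↦ f`; the extra variable
`y` is `X none`. -/
noncomputable def substHom {K : Type*} [Field K] {σ : Type*} (f : MvPolynomial σ K) :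
    MvPolynomial (Option σ) K →ₐ[K] MvPolynomial σ K :=
  aeval fun o => o.elim f X

/-- The polynomial `y - f`, which generates the kernel of the substitution `y ↦ f`. -/
noncomputable def graphPoly {K : Type*} [Field K] {σ : Type*} (f : MvPolynomial σ K) :
    MvPolynomial (Option σ) K :=
  X none - rename some f

lemma substHom_graphPoly {K : Type*} [Field K] {σ : Type*} (f : MvPolynomial σ K) :
    substHom f (graphPoly f) = 0 := by
  simp only [substHom, graphPoly, map_sub, aeval_X, aeval_rename, Option.elim]
  rw [sub_eq_zero]
  exact (aeval_X_left_apply f).symm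

lemma graphPoly_dvd {K : Type*} [Field K] {σ : Type*} (f : MvPolynomial σ K)
    {g : MvPolynomial (Option σ) K} (hg : substHom f g = 0) : graphPoly f ∣ g := by
  let e := optionEquivLeft K σ
  have he : e (graphPoly f) = Polynomial.X - Polynomial.C f := by
    have h : (e.toAlgHom.comp (rename some)) =
        (Polynomial.CAlgHom (R := K) (A := MvPolynomial σ K)) := by
      ext i : 1
      simp [e, optionEquivLeft_X_some, Polynomial.CAlgHom]
    have h' : e (rename some f) = Polynomial.C f := congrArg (fun φ => φ f) h
    simp [graphPoly, h', e, optionEquivLeft_X_none]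
  have hs : ∀ g, substHom f g = (e g).eval f := by
    intro g
    have h : substHom f = ((Polynomial.aeval (R := MvPolynomial σ K) f).restrictScalars K).comp
        e.toAlgHom := by
      ext o : 1
      cases o <;> simp [substHom, e, optionEquivLeft_X_some, optionEquivLeft_X_none]
    rw [h]
    simp [Polynomial.coe_aeval_eq_eval]
  have : e (graphPoly f) ∣ e g := by
    rw [he, Polynomial.dvd_iff_isRoot, Polynomial.IsRoot, ← hs, hg]
  exact (map_dvd_iff e).1 this

lemma graphPoly_ne_zero {K : Type*} [Field K] {σ : Type*} (f : MvPolynomial σ K) :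
    graphPoly f ≠ 0 := by
  intro h
  have := congrArg (eval fun o : Option σ => o.elim (eval 0 f + 1) 0) h
  simp only [graphPoly, map_sub, eval_X, eval_rename, map_zero] at this
  have h0 : ((fun o : Option σ => o.elim (eval 0 f + 1) 0) ∘ some) = (0 : σ → K) := rfl
  rw [h0] at this
  simp at this

lemma one_le_totalDegree_graphPoly {K : Type*} [Field K] {σ : Type*} (f : MvPolynomial σ K) :
    1 ≤ (graphPoly f).totalDegree := by
  by_contra h
  have h0 : (graphPoly f).totalDegree = 0 := by omega
  rw [totalDegree_eq_zero_iff_eq_C] at h0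
  have := substHom_graphPoly f
  rw [h0] at this
  have hc : coeff 0 (graphPoly f) = 0 := by simpa [substHom] using this
  rw [hc, C_0] at h0
  exact graphPoly_ne_zero f h0

lemma totalDegree_graphPoly_le {K : Type*} [Field K] {σ : Type*} (f : MvPolynomial σ K) {Δ : ℕ}
    (hΔ : 1 ≤ Δ) (hf : f.totalDegree ≤ Δ) : (graphPoly f).totalDegree ≤ Δ := by
  refine (totalDegree_sub _ _).trans (max_le ?_ ((totalDegree_rename_le _ _).trans hf))
  rwa [totalDegree_X]

/-- The polynomials of degree at most `t` that die under `y ↦ f` are the products of `y - f` with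
the polynomials of degree at most `t - deg (y - f)`, so the image has the dimension of the space
of polynomials of degree in `(t - deg (y - f), t]`. -/
lemma finrank_map_substHom {K : Type*} [Field K] {d : ℕ} (f : MvPolynomial (Fin d) K) {t : ℕ}
    (ht : (graphPoly f).totalDegree ≤ t) :
    Module.finrank K ((restrictTotalDegree (Option (Fin d)) K t).map (substHom f).toLinearMap) =
      ∑ j ∈ Finset.range (graphPoly f).totalDegree, (t - j + d).choose d := by
  set e := (graphPoly f).totalDegree with he
  have hcard : Fintype.card (Option (Fin d)) = d + 1 := by simp
  let P := restrictTotalDegree (Option (Fin d)) K t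
  let Q := restrictTotalDegree (Option (Fin d)) K (t - e)
  let L : P →ₗ[K] MvPolynomial (Fin d) K := (substHom f).toLinearMap ∘ₗ P.subtype
  have hrange : LinearMap.range L = P.map (substHom f).toLinearMap := by
    rw [LinearMap.range_comp, Submodule.range_subtype]
  have hmul : ∀ g : MvPolynomial (Option (Fin d)) K,
      (graphPoly f * g).totalDegree ≤ t ↔ g.totalDegree ≤ t - e := by
    intro g
    rcases eq_or_ne g 0 with rfl | hg
    · simp
    · rw [totalDegree_mul_of_isDomain (graphPoly_ne_zero f) hg]
      omega
  let M : Q →ₗ[K] MvPolynomial (Option (Fin d)) K :=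
    (LinearMap.mulLeft K (graphPoly f)) ∘ₗ Q.subtype
  have hMinj : Function.Injective M := by
    intro a b hab
    exact Subtype.ext (mul_left_cancel₀ (graphPoly_ne_zero f) hab)
  have hker : (LinearMap.ker L).map P.subtype = LinearMap.range M := by
    ext g
    constructor
    · rintro ⟨⟨g, hgP⟩, hg, rfl⟩
      obtain ⟨h, rfl⟩ := graphPoly_dvd f (g := g) hg
      exact ⟨⟨h, (mem_restrictTotalDegree _ _ _).2
        ((hmul h).1 ((mem_restrictTotalDegree _ _ _).1 hgP))⟩, rfl⟩
    · rintro ⟨⟨h, hQ⟩, rfl⟩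
      refine ⟨⟨graphPoly f * h, (mem_restrictTotalDegree _ _ _).2
        ((hmul h).2 ((mem_restrictTotalDegree _ _ _).1 hQ))⟩, ?_, rfl⟩
      change substHom f (graphPoly f * h) = 0
      rw [map_mul, substHom_graphPoly, zero_mul]
  have h1 : Module.finrank K (LinearMap.ker L) = Module.finrank K Q := by
    rw [← LinearMap.finrank_range_of_inj hMinj, ← hker]
    exact (Submodule.finrank_map_subtype_eq P (LinearMap.ker L)).symm
  have h2 := LinearMap.finrank_range_add_finrank_ker L
  rw [hrange, h1, finrank_restrictTotalDegree K hcard, finrank_restrictTotalDegree K hcard] at h2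
  have h3 : ∑ k ∈ Finset.range (t + 1), (k + d).choose d =
      ∑ k ∈ Finset.range (t - e + 1), (k + d).choose d +
        ∑ j ∈ Finset.range e, (t - j + d).choose d := by
    rw [show t + 1 = (t - e + 1) + e by omega, Finset.sum_range_add, add_right_inj,
      ← Finset.sum_range_reflect]
    refine Finset.sum_congr rfl fun j hj => ?_
    rw [Finset.mem_range] at hj
    congr 2
    omega
  change Module.finrank K (P.map (substHom f).toLinearMap) = _
  omega

/-! ### Hilbert functions of closures of affine sets -/

lemma eval_rep_toProj_eq_zero_iff {K : Type*} [Field K] {D t : ℕ}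
    {g : MvPolynomial (Fin (D + 1)) K} (hg : g.IsHomogeneous t) (a : Fin D → K) :
    eval (toProj a).rep g = 0 ↔ eval (Fin.cons 1 a : Fin (D + 1) → K) g = 0 := by
  obtain ⟨c, hc⟩ := Projectivization.exists_smul_eq_mk_rep K (Fin.cons 1 a : Fin (D + 1) → K)
    (fun h => one_ne_zero (congrFun h 0 : (1 : K) = 0))
  have hc' : (toProj a).rep = (c : K) • (Fin.cons 1 a : Fin (D + 1) → K) := hc.symm
  rw [hc', eval_smul_of_isHomogeneous hg]
  simp

/-- Passing to the projective closure does not change the vanishing ideal. -/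
lemma idealPart_projClosure {K : Type*} [Field K] {D : ℕ} (V : Set (Fin D → K)) (t : ℕ) :
    idealPart (projClosure V) t = idealPart (toProj '' V) t := by
  ext g
  constructor
  · intro hg x hx
    exact hg x fun k f hf => hf x hx
  · intro hg x hx
    exact hx t g hg

/-! ### Graphs of polynomials as varieties -/

/-- The point `(x₁, …, x_d, y, 0, …, 0)` of `R^D`, meaningful for `d < D`. -/
def pad {R : Type*} [Zero R] {d : ℕ} (D : ℕ) (x : Fin d → R) (y : R) : Fin D → R :=
  fun i => if h : (i : ℕ) < d then x ⟨i, h⟩ else if (i : ℕ) = d then y else 0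

lemma map_pad {R S G : Type*} [Zero R] [Zero S] [FunLike G R S] [ZeroHomClass G R S] {d D : ℕ}
    (φ : G) (x : Fin d → R) (y : R) (i : Fin D) :
    φ (pad D x y i) = pad D (fun j => φ (x j)) (φ y) i := by
  unfold pad
  split_ifs <;> simp

lemma pad_castLE {R : Type*} [Zero R] {d D : ℕ} (hD : d < D) (x : Fin d → R) (y : R) (i : Fin d) :
    pad D x y (Fin.castLE hD.le i) = x i := by
  simp [pad]

lemma pad_self {R : Type*} [Zero R] {d D : ℕ} (hD : d < D) (x : Fin d → R) (y : R) :
    pad D x y ⟨d, hD⟩ = y := by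
  simp [pad]

lemma pad_injective {R : Type*} [Zero R] {d D : ℕ} (hD : d < D) {x x' : Fin d → R} {y y' : R}
    (h : pad D x y = pad D x' y') : x = x' ∧ y = y' := by
  constructor
  · funext i
    rw [← pad_castLE hD x y i, h, pad_castLE hD]
  · rw [← pad_self hD x y, h, pad_self hD]

/-- The graph of the polynomial function `f` on `K^d`, placed in the first `d + 1` coordinates
of `K^D`. -/
def graphVariety {K : Type*} [Field K] {d : ℕ} (D : ℕ) (f : MvPolynomial (Fin d) K) :
    Set (Fin D → K) :=
  Set.range fun x => pad D x (eval x f)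

section

variable {K : Type*} [Field K] {d D : ℕ}

lemma pad_mem_graphVariety (hD : d < D) (f : MvPolynomial (Fin d) K) (x : Fin d → K) (y : K) :
    pad D x y ∈ graphVariety D f ↔ y = eval x f := by
  constructor
  · rintro ⟨x', h⟩
    obtain ⟨rfl, rfl⟩ := pad_injective hD h
    rfl
  · rintro rfl
    exact ⟨x, rfl⟩

lemma algebraMap_pad_mem_graphVariety {F : Type*} [Field F] [Algebra F K] (hD : d < D)
    (f : MvPolynomial (Fin d) F) (x : Fin d → F) (y : F) :
    (fun k => algebraMap F K (pad D x y k)) ∈ graphVariety D (map (algebraMap F K) f) ↔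
      y = eval x f := by
  have h₁ : (fun k => algebraMap F K (pad D x y k)) =
      pad D (fun j => algebraMap F K (x j)) (algebraMap F K y) :=
    funext fun k => map_pad _ _ _ _
  have h₂ : eval (fun j => algebraMap F K (x j)) (map (algebraMap F K) f) =
      algebraMap F K (eval x f) := by
    rw [eval_map]
    exact (eval₂_comp_left _ (RingHom.id _) x f).symm
  rw [h₁, pad_mem_graphVariety hD, h₂]
  exact (algebraMap F K).injective.eq_iff

lemma graphVariety_injective [Infinite K] (hD : d < D) :
    Function.Injective (graphVariety D : MvPolynomial (Fin d) K → Set (Fin D → K)) := by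
  intro f g h
  refine MvPolynomial.funext fun x => ?_
  rw [← pad_mem_graphVariety hD, ← h, pad_mem_graphVariety hD]

/-- A graph is defined over the field of the coefficients of the polynomial. -/
lemma isAlgebraicSet_graphVariety {F : Type*} [Field F] [Algebra F K] (hD : d < D)
    (f : MvPolynomial (Fin d) F) :
    IsAlgebraicSet F (graphVariety D (map (algebraMap F K) f)) := by
  classical
  refine ⟨Finset.univ.image fun i : Fin D =>
    X i - pad D (fun j => X (Fin.castLE hD.le j)) (rename (Fin.castLE hD.le) f) i, ?_⟩
  have key : ∀ (a : Fin D → K) (i : Fin D),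
      aeval a (X i - pad D (fun j => X (Fin.castLE hD.le j)) (rename (Fin.castLE hD.le) f) i) =
      a i - pad D (fun j => a (Fin.castLE hD.le j))
        (eval (fun j => a (Fin.castLE hD.le j)) (map (algebraMap F K) f)) i := by
    intro a i
    rw [map_sub, map_pad]
    simp only [aeval_X, aeval_rename, eval_map]
    rfl
  ext a
  simp only [Finset.mem_image, Finset.mem_univ, true_and, forall_exists_index,
    forall_apply_eq_imp_iff, Set.mem_ofPred_eq, key, sub_eq_zero]
  constructor
  · rintro ⟨x, rfl⟩ i
    simp only [pad_castLE hD]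
  · intro h
    exact ⟨_, (funext h).symm⟩

/-- Two polynomials not vanishing identically on the graph pull back to nonzero polynomials on
`K^d`, whose product is nonzero; hence the graph is irreducible. -/
lemma isVariety_graphVariety [Infinite K] (hD : d < D) (f : MvPolynomial (Fin d) K) :
    IsVariety (graphVariety D f) where
  algebraic := by
    have := isAlgebraicSet_graphVariety (K := K) hD f
    rwa [Algebra.algebraMap_self, map_id] at this
  nonempty := ⟨_, 0, rfl⟩
  irreducible := by
    let φ : Fin D → MvPolynomial (Fin d) K := pad D X f
    have hφ : ∀ x g, eval x (aeval φ g) = eval (pad D x (eval x f)) g := by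
      intro x g
      rw [eval_aeval]
      congr 2
      funext i
      simp [φ, map_pad]
    have aux : ∀ V : Set (Fin D → K), IsAlgebraicSet K V → V ⊂ graphVariety D f →
        ∃ g, aeval φ g ≠ 0 ∧ ∀ a ∈ V, eval a g = 0 := by
      rintro V ⟨S, rfl⟩ hV
      obtain ⟨_, ⟨x, rfl⟩, hx⟩ := Set.exists_of_ssubset hV
      simp only [Set.mem_ofPred_eq, not_forall] at hx
      obtain ⟨g, hg, hgx⟩ := hx
      refine ⟨g, fun h => hgx ?_, fun a ha => ha g hg⟩
      have := hφ x g
      rw [h, map_zero] at this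
      exact this.symm
    intro V₁ V₂ h₁ h₂ hV₁ hV₂ hV
    obtain ⟨g₁, hg₁, hg₁V⟩ := aux V₁ h₁ hV₁
    obtain ⟨g₂, hg₂, hg₂V⟩ := aux V₂ h₂ hV₂
    refine mul_ne_zero hg₁ hg₂ (MvPolynomial.funext fun x => ?_)
    have hx : pad D x (eval x f) ∈ V₁ ∪ V₂ := hV ▸ ⟨x, rfl⟩
    rw [map_mul, hφ, hφ, map_zero]
    rcases hx with hx | hx
    · rw [hg₁V _ hx, zero_mul]
    · rw [hg₂V _ hx, mul_zero]

/-- Restriction of homogeneous polynomials of degree `t` to the graph of `f`, written in the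
coordinates `x₁, …, x_d`: the substitution `(1, x₁, …, x_d, f, 0, …, 0)`. -/
noncomputable def restrictToGraph (D : ℕ) (f : MvPolynomial (Fin d) K) (t : ℕ) :
    homogeneousSubmodule (Fin (D + 1)) K t →ₗ[K] MvPolynomial (Fin d) K :=
  (aeval (Fin.cons 1 (pad D X f) : Fin (D + 1) → MvPolynomial (Fin d) K)).toLinearMap ∘ₗ
    (homogeneousSubmodule (Fin (D + 1)) K t).subtype

lemma ker_restrictToGraph [Infinite K] (f : MvPolynomial (Fin d) K) (t : ℕ) :
    LinearMap.ker (restrictToGraph D f t) = idealPart (projClosure (graphVariety D f)) t := by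
  have hφ : ∀ x g,
      eval x (aeval (Fin.cons 1 (pad D X f) : Fin (D + 1) → MvPolynomial (Fin d) K) g) =
        eval (Fin.cons 1 (pad D x (eval x f)) : Fin (D + 1) → K) g := by
    intro x g
    rw [eval_aeval]
    congr 2
    funext i
    refine Fin.cases ?_ (fun i => ?_) i
    · simp
    · simp [map_pad]
  rw [idealPart_projClosure]
  ext ⟨g, hg⟩
  have hg' : g.IsHomogeneous t := (mem_homogeneousSubmodule t g).1 hg
  constructor
  · rintro h _ ⟨_, ⟨x, rfl⟩, rfl⟩
    refine (eval_rep_toProj_eq_zero_iff hg' _).2 ?_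
    have h' : aeval (Fin.cons 1 (pad D X f) : Fin (D + 1) → MvPolynomial (Fin d) K) g = 0 := h
    rw [← hφ, h', map_zero]
  · intro h
    refine MvPolynomial.funext fun x => ?_
    rw [map_zero]
    exact (hφ x g).trans
      ((eval_rep_toProj_eq_zero_iff hg' _).1 (h _ ⟨_, ⟨x, rfl⟩, rfl⟩))

/-- Dehomogenization turns the homogeneous polynomials of degree `t` in `D + 1` variables into all
polynomials of degree at most `t`; the variables that vanish on the graph play no role. -/
lemma range_restrictToGraph (hD : d < D) (f : MvPolynomial (Fin d) K) (t : ℕ) :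
    LinearMap.range (restrictToGraph D f t) =
      (restrictTotalDegree (Option (Fin d)) K t).map (substHom f).toLinearMap := by
  apply le_antisymm
  · rintro _ ⟨⟨g, hg⟩, rfl⟩
    let v : Fin (D + 1) → MvPolynomial (Option (Fin d)) K :=
      Fin.cons 1 (pad D (fun j => X (some j)) (X none))
    have hv : ∀ i, (v i).totalDegree ≤ 1 := by
      intro i
      refine Fin.cases ?_ (fun i => ?_) i
      · simp [v]
      · simp only [v, Fin.cons_succ, pad]
        split_ifs <;> simp
    refine ⟨aeval v g, (mem_restrictTotalDegree _ _ _).2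
      ((totalDegree_aeval_le hv g).trans ((mem_homogeneousSubmodule t g).1 hg).totalDegree_le), ?_⟩
    have h := congrArg (fun φ : MvPolynomial (Fin (D + 1)) K →ₐ[K] _ => φ g)
      (comp_aeval v (substHom f))
    refine h.trans (congrArg (fun w : Fin (D + 1) → _ => aeval w g) (funext fun i => ?_))
    refine Fin.cases ?_ (fun i => ?_) i
    · simp [v]
    · simp [v, map_pad, substHom]
  · rw [restrictTotalDegree, restrictSupport_eq_span, Submodule.map_span, Submodule.span_le]
    rintro _ ⟨_, ⟨m, hm, rfl⟩, rfl⟩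
    let ι : Option (Fin d) → Fin (D + 1) := fun o =>
      o.elim (Fin.succ ⟨d, hD⟩) fun j => Fin.succ (Fin.castLE hD.le j)
    have hdeg : m.degree ≤ t := hm
    have hw : (Fin.cons 1 (pad D X f) : Fin (D + 1) → MvPolynomial (Fin d) K) ∘ ι =
        fun o => o.elim f X := by
      funext o
      cases o with
      | none => exact pad_self hD X f
      | some j => exact pad_castLE hD X f j
    have hM : aeval (Fin.cons 1 (pad D X f) : Fin (D + 1) → MvPolynomial (Fin d) K)
        (X 0 ^ (t - m.degree) * rename ι (monomial m (1 : K))) =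
          substHom f (monomial m (1 : K)) := by
      rw [map_mul, map_pow, aeval_X, Fin.cons_zero, one_pow, one_mul, aeval_rename, hw, substHom]
    refine ⟨⟨X 0 ^ (t - m.degree) * rename ι (monomial m 1), ?_⟩, ?_⟩
    · rw [mem_homogeneousSubmodule]
      have h1 : (X 0 ^ (t - m.degree) : MvPolynomial (Fin (D + 1)) K).IsHomogeneous
          (t - m.degree) := isHomogeneous_X_pow 0 _
      have h2 := h1.mul ((isHomogeneous_monomial (1 : K) (d := m) rfl).rename_isHomogeneous (f := ι))
      rwa [Nat.sub_add_cancel hdeg] at h2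
    · exact hM

/-- The Hilbert polynomial of the graph of `f` is `∑_{j < e} C(t - j + d, d)` with
`e = deg (y - f)`. -/
lemma isHilbertPolynomial_graphVariety [Infinite K] (hD : d < D) (f : MvPolynomial (Fin d) K) :
    IsHilbertPolynomial (projClosure (graphVariety D f))
      (∑ j ∈ Finset.range (graphPoly f).totalDegree, Polynomial.preHilbertPoly ℚ d j) := by
  filter_upwards [Filter.eventually_ge_atTop (graphPoly f).totalDegree] with t ht
  have h : hilbertFunction (projClosure (graphVariety D f)) t =
      ∑ j ∈ Finset.range (graphPoly f).totalDegree, (t - j + d).choose d := by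
    rw [hilbertFunction, ← ker_restrictToGraph,
      (LinearMap.quotKerEquivRange (restrictToGraph D f t)).finrank_eq,
      range_restrictToGraph hD, finrank_map_substHom f ht]
  rw [h, Polynomial.eval_finsetSum]
  push_cast
  refine Finset.sum_congr rfl fun j hj => ?_
  rw [Polynomial.preHilbertPoly_eq_choose_sub_add]
  exact (Finset.mem_range.1 hj).le.trans ht

end

lemma degree_and_coeff_sum_preHilbertPoly (d : ℕ) {e : ℕ} (he : 1 ≤ e) :
    (∑ j ∈ Finset.range e, Polynomial.preHilbertPoly ℚ d j).degree = (d : WithBot ℕ) ∧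
    (∑ j ∈ Finset.range e, Polynomial.preHilbertPoly ℚ d j).coeff d = e / d.factorial := by
  have hc : (∑ j ∈ Finset.range e, Polynomial.preHilbertPoly ℚ d j).coeff d = e / d.factorial := by
    rw [Polynomial.finsetSum_coeff]
    simp only [Polynomial.coeff_preHilbertPoly_self]
    simp [div_eq_mul_inv]
  refine ⟨le_antisymm ?_ ?_, hc⟩
  · refine (Polynomial.degree_sum_le _ _).trans (Finset.sup_le fun j _ => ?_)
    exact Polynomial.degree_le_natDegree.trans (by rw [Polynomial.natDegree_preHilbertPoly])
  · refine Polynomial.le_degree_of_ne_zero ?_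
    rw [hc]
    positivity

lemma hasDimension_graphVariety {K : Type*} [Field K] [Infinite K] {d D : ℕ} (hD : d < D)
    (f : MvPolynomial (Fin d) K) : HasDimension (graphVariety D f) d :=
  ⟨_, isHilbertPolynomial_graphVariety hD f,
    (degree_and_coeff_sum_preHilbertPoly d (one_le_totalDegree_graphPoly f)).1⟩

lemma hasDegree_graphVariety {K : Type*} [Field K] [Infinite K] {d D : ℕ} (hD : d < D)
    (f : MvPolynomial (Fin d) K) : HasDegree (graphVariety D f) (graphPoly f).totalDegree := by
  refine ⟨_, isHilbertPolynomial_graphVariety hD f, ?_⟩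
  obtain ⟨h1, h2⟩ := degree_and_coeff_sum_preHilbertPoly d (one_le_totalDegree_graphPoly f)
  rw [Polynomial.leadingCoeff, Polynomial.natDegree_eq_of_degree_eq_some h1, h2]
  field_simp

/-! ### Interpolation over a finite field -/

/-- Lagrange interpolation at `T` distinct points of `F^d` by a polynomial of degree less
than `T`. -/
lemma exists_interpolation {F : Type*} [Field F] {d T : ℕ} {x : Fin T → Fin d → F}
    (hx : Function.Injective x) (y : Fin T → F) :
    ∃ f : MvPolynomial (Fin d) F, f.totalDegree ≤ T - 1 ∧ ∀ i, eval (x i) f = y i := by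
  classical
  have hk : ∀ i j, ∃ l : MvPolynomial (Fin d) F, l.totalDegree ≤ 1 ∧
      (i ≠ j → eval (x i) l = 1 ∧ eval (x j) l = 0) := by
    intro i j
    by_cases hij : i = j
    · exact ⟨0, by simp, fun h => absurd hij h⟩
    · obtain ⟨k, hk⟩ := Function.ne_iff.1 (hx.ne hij)
      refine ⟨C (x i k - x j k)⁻¹ * (X k - C (x j k)), ?_, fun _ => ⟨?_, ?_⟩⟩
      · refine (totalDegree_mul _ _).trans ?_
        rw [totalDegree_C, zero_add]
        exact (totalDegree_sub _ _).trans (by simp)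
      · simp [inv_mul_cancel₀ (sub_ne_zero.2 hk)]
      · simp
  choose l hl hl' using hk
  refine ⟨∑ i, C (y i) * ∏ j ∈ Finset.univ.erase i, l i j, ?_, fun i => ?_⟩
  · refine totalDegree_finsetSum_le fun i _ => (totalDegree_mul _ _).trans ?_
    rw [totalDegree_C, zero_add]
    refine (totalDegree_finsetProd _ _).trans ((Finset.sum_le_card_nsmul _ _ 1
      fun j _ => hl i j).trans ?_)
    simp
  · rw [map_sum, Finset.sum_eq_single i]
    · rw [map_mul, eval_C, map_prod, Finset.prod_eq_one, mul_one]
      intro j hj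
      exact (hl' i j (Finset.ne_of_mem_erase hj).symm).1
    · intro k _ hki
      rw [map_mul, map_prod, Finset.prod_eq_zero (i := i), mul_zero]
      · exact Finset.mem_erase.2 ⟨hki.symm, Finset.mem_univ _⟩
      · exact (hl' k i hki).2
    · simp

/-- Evaluation at `T` distinct points equidistributes the polynomials of degree at most `Δ`,
when `T ≤ Δ + 1`. -/
lemma card_filter_eval_eq_mul {F : Type*} [Field F] [Fintype F] {d Δ T : ℕ}
    [Fintype (restrictTotalDegree (Fin d) F Δ)] (hT : T ≤ Δ + 1)
    {x : Fin T → Fin d → F} (hx : Function.Injective x) (y : Fin T → F)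
    [DecidablePred fun w : restrictTotalDegree (Fin d) F Δ => ∀ i, eval (x i) w.1 = y i] :
    (Finset.univ.filter fun w : restrictTotalDegree (Fin d) F Δ =>
      ∀ i, eval (x i) w.1 = y i).card * Fintype.card F ^ T =
        Fintype.card (restrictTotalDegree (Fin d) F Δ) := by
  classical
  let E : restrictTotalDegree (Fin d) F Δ →+ (Fin T → F) :=
    { toFun := fun w i => eval (x i) w.1
      map_zero' := by funext i; simp
      map_add' := fun a b => by funext i; simp }
  have hE : ∀ z, z ∈ Set.range E := by
    intro z
    obtain ⟨f, hf, hfz⟩ := exists_interpolation hx z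
    exact ⟨⟨f, (mem_restrictTotalDegree _ _ _).2 (hf.trans (by omega))⟩, funext hfz⟩
  have hcard : Fintype.card (Fin T → F) = Fintype.card F ^ T := by simp
  have hsum := Finset.card_eq_sum_card_fiberwise (s := Finset.univ) (t := Finset.univ) (f := E)
    (fun _ _ => Finset.mem_coe.2 (Finset.mem_univ _))
  have hconst : ∀ z ∈ (Finset.univ : Finset (Fin T → F)),
      (Finset.univ.filter fun w => E w = z).card = (Finset.univ.filter fun w => E w = y).card :=
    fun z _ => AddMonoidHom.card_fiber_eq_of_mem_range E (hE z) (hE y)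
  rw [Finset.sum_congr rfl hconst, Finset.sum_const, Finset.card_univ, Finset.card_univ, hcard,
    smul_eq_mul, mul_comm] at hsum
  rw [hsum]
  congr 2
  ext w
  simp only [Finset.mem_filter, Finset.mem_univ, true_and]
  exact funext_iff.symm

/-! ### Random families without complete bipartite incidence patterns -/

lemma card_filter_apply_eq_mul_le {W : Type*} [Fintype W] [DecidableEq W] {n : ℕ} {i j : Fin n}
    (hij : i ≠ j) :
    (Finset.univ.filter fun g : Fin n → W => g i = g j).card * Fintype.card W ≤
      Fintype.card W ^ n := by
  have hle : (Finset.univ.filter fun g : Fin n → W => g i = g j).card ≤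
      Fintype.card ({k : Fin n // k ≠ i} → W) := by
    rw [← Finset.card_univ]
    refine Finset.card_le_card_of_injOn (fun g k => g k.1) (fun _ _ => by simp) ?_
    intro g hg g' hg' h
    have hne : ∀ k, k ≠ i → g k = g' k := fun k hk => congrFun h ⟨k, hk⟩
    simp only [Finset.coe_filter, Finset.mem_univ, true_and, Set.mem_ofPred_eq] at hg hg'
    funext k
    by_cases hk : k = i
    · rw [hk, hg, hg', hne j hij.symm]
    · exact hne k hk
  have hc : Fintype.card ({k : Fin n // k ≠ i} → W) = Fintype.card W ^ (n - 1) := by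
    simp
  have hn : n - 1 + 1 = n := by
    have := i.2
    omega
  calc _ ≤ Fintype.card W ^ (n - 1) * Fintype.card W := Nat.mul_le_mul_right _ (hle.trans hc.le)
    _ = Fintype.card W ^ n := by rw [← pow_succ, hn]

lemma card_filter_forall_mem_mul_le {W : Type*} [Fintype W] {n s k : ℕ} {v : Fin s → Fin n}
    (hv : Function.Injective v) (B : Finset W) (hB : B.card * k ≤ Fintype.card W)
    [DecidablePred fun g : Fin n → W => ∀ b, g (v b) ∈ B] :
    (Finset.univ.filter fun g : Fin n → W => ∀ b, g (v b) ∈ B).card * k ^ s ≤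
      Fintype.card W ^ n := by
  classical
  have hset : (Finset.univ.filter fun g : Fin n → W => ∀ b, g (v b) ∈ B) =
      Fintype.piFinset fun i => if i ∈ Finset.univ.image v then B else Finset.univ := by
    ext g
    simp only [Finset.mem_filter, Finset.mem_univ, true_and, Fintype.mem_piFinset]
    constructor
    · intro h i
      split_ifs with hi
      · obtain ⟨b, -, rfl⟩ := Finset.mem_image.1 hi
        exact h b
      · exact Finset.mem_univ _
    · intro h b
      simpa using h (v b)
  have hk : k ^ s = ∏ i : Fin n, if i ∈ Finset.univ.image v then k else 1 := by
    rw [Finset.prod_ite_mem, Finset.univ_inter, Finset.prod_const,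
      Finset.card_image_of_injective _ hv]
    simp
  have hq : Fintype.card W ^ n = ∏ _i : Fin n, Fintype.card W := by simp
  rw [hset, Fintype.card_piFinset, hk, ← Finset.prod_mul_distrib, hq]
  refine Finset.prod_le_prod' fun i _ => ?_
  split_ifs
  · exact hB
  · simp

/-- If every `s` distinct points are simultaneously incident to at most a `k⁻¹` proportion of `W`,
then some `n` distinct members of `W` have no `K_{s,s}` among their incidences: a uniformly random
sequence of length `n` fails to be injective with probability at most `n² / |W|`, and contains a
`K_{s,s}` with probability at most `|Q|^s n^s k^{-s}`. -/
lemma exists_injective_family_without_biclique {W Q : Type*} [Fintype W] [Nonempty W] [Fintype Q]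
    (R : Q → W → Prop) [∀ x w, Decidable (R x w)] {s n k : ℕ} (hk : 0 < k)
    (hR : ∀ u : Fin s → Q, Function.Injective u →
      (Finset.univ.filter fun w => ∀ a, R (u a) w).card * k ≤ Fintype.card W)
    (h₁ : 4 * (n * n) ≤ Fintype.card W) (h₂ : 4 * (Fintype.card Q ^ s * n ^ s) ≤ k ^ s) :
    ∃ g : Fin n → W, Function.Injective g ∧
      ∀ u : Fin s → Q, Function.Injective u → ∀ v : Fin s → Fin n, Function.Injective v →
        ¬ ∀ a b, R (u a) (g (v b)) := by
  classical
  set q := Fintype.card W with hq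
  have hq0 : 0 < q := Fintype.card_pos
  let B₁ : Finset (Fin n → W) := (Finset.univ.filter fun ij : Fin n × Fin n => ij.1 ≠ ij.2).biUnion
    fun ij => Finset.univ.filter fun g => g ij.1 = g ij.2
  let B₂ : Finset (Fin n → W) := (Finset.univ.filter fun uv : (Fin s → Q) × (Fin s → Fin n) =>
    Function.Injective uv.1 ∧ Function.Injective uv.2).biUnion
    fun uv => Finset.univ.filter fun g => ∀ b, g (uv.2 b) ∈
      Finset.univ.filter fun w => ∀ a, R (uv.1 a) w
  have hB₁ : 4 * B₁.card ≤ q ^ n := by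
    have h : B₁.card * q ≤ n * n * q ^ n := by
      calc B₁.card * q ≤ (∑ ij ∈ Finset.univ.filter fun ij : Fin n × Fin n => ij.1 ≠ ij.2,
            (Finset.univ.filter fun g : Fin n → W => g ij.1 = g ij.2).card) * q :=
            Nat.mul_le_mul_right _ Finset.card_biUnion_le
        _ ≤ ∑ ij ∈ Finset.univ.filter fun ij : Fin n × Fin n => ij.1 ≠ ij.2, q ^ n := by
            rw [Finset.sum_mul]
            exact Finset.sum_le_sum fun ij hij =>
              card_filter_apply_eq_mul_le (Finset.mem_filter.1 hij).2
        _ ≤ n * n * q ^ n := by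
            rw [Finset.sum_const, smul_eq_mul]
            refine Nat.mul_le_mul_right _ ((Finset.card_le_univ _).trans ?_)
            simp
    refine Nat.le_of_mul_le_mul_right ?_ hq0
    calc 4 * B₁.card * q ≤ 4 * (n * n) * q ^ n := by
          rw [mul_assoc, mul_assoc]; exact Nat.mul_le_mul_left _ h
      _ ≤ q ^ n * q := by rw [mul_comm (q ^ n)]; exact Nat.mul_le_mul_right _ h₁
  have hB₂ : 4 * B₂.card ≤ q ^ n := by
    have h : B₂.card * k ^ s ≤ Fintype.card Q ^ s * n ^ s * q ^ n := by
      calc B₂.card * k ^ s ≤ (∑ uv ∈ Finset.univ.filter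
            fun uv : (Fin s → Q) × (Fin s → Fin n) =>
              Function.Injective uv.1 ∧ Function.Injective uv.2,
            (Finset.univ.filter fun g : Fin n → W => ∀ b, g (uv.2 b) ∈
              Finset.univ.filter fun w => ∀ a, R (uv.1 a) w).card) * k ^ s :=
            Nat.mul_le_mul_right _ Finset.card_biUnion_le
        _ ≤ ∑ uv ∈ Finset.univ.filter fun uv : (Fin s → Q) × (Fin s → Fin n) =>
              Function.Injective uv.1 ∧ Function.Injective uv.2, q ^ n := by
            rw [Finset.sum_mul]
            refine Finset.sum_le_sum fun uv huv => ?_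
            obtain ⟨-, hu, hv⟩ := Finset.mem_filter.1 huv
            exact card_filter_forall_mem_mul_le hv _ (hR uv.1 hu)
        _ ≤ Fintype.card Q ^ s * n ^ s * q ^ n := by
            rw [Finset.sum_const, smul_eq_mul]
            refine Nat.mul_le_mul_right _ ((Finset.card_le_univ _).trans ?_)
            simp
    refine Nat.le_of_mul_le_mul_right ?_ (pow_pos hk s)
    calc 4 * B₂.card * k ^ s ≤ 4 * (Fintype.card Q ^ s * n ^ s) * q ^ n := by
          rw [mul_assoc, mul_assoc]; exact Nat.mul_le_mul_left _ h
      _ ≤ q ^ n * k ^ s := by rw [mul_comm (q ^ n)]; exact Nat.mul_le_mul_right _ h₂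
  have hlt : (B₁ ∪ B₂).card < (Finset.univ : Finset (Fin n → W)).card := by
    have h := Finset.card_union_le B₁ B₂
    have hpos : 0 < q ^ n := pow_pos hq0 n
    have hu : (Finset.univ : Finset (Fin n → W)).card = q ^ n := by
      rw [Finset.card_univ, Fintype.card_fun, Fintype.card_fin]
    omega
  obtain ⟨g, -, hg⟩ := Finset.exists_mem_notMem_of_card_lt_card hlt
  rw [Finset.mem_union, not_or] at hg
  refine ⟨g, fun i j hij => ?_, fun u hu v hv huv => hg.2 ?_⟩
  · by_contra hne
    exact hg.1 (Finset.mem_biUnion.2 ⟨(i, j), by simpa using hne, by simpa using hij⟩)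
  · exact Finset.mem_biUnion.2 ⟨(u, v), by simpa using ⟨hu, hv⟩,
      by simpa using fun b a => huv a b⟩

/-- Distinct polynomials of degree at most `Δ` whose graphs contain no `K_{s,s}` with points
of `Q`. -/
lemma exists_polynomials_without_biclique {F : Type*} [Field F] [Fintype F] {d s n Δ T : ℕ}
    (Q : Finset ((Fin d → F) × F)) (hs : s ≤ Δ + 1) (hT : T ≤ Δ + 1)
    (hTd : T ≤ Fintype.card F ^ d) (h₁ : 4 * (n * n) ≤ Fintype.card F ^ T)
    (h₂ : 4 * (Q.card ^ s * n ^ s) ≤ Fintype.card F ^ (s * s)) :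
    ∃ g : Fin n → MvPolynomial (Fin d) F, Function.Injective g ∧ (∀ i, (g i).totalDegree ≤ Δ) ∧
      ∀ u : Fin s → (Fin d → F) × F, Function.Injective u → (∀ a, u a ∈ Q) →
        ∀ v : Fin s → Fin n, Function.Injective v →
          ¬ ∀ a b, (u a).2 = eval (u a).1 (g (v b)) := by
  classical
  have : Finite (restrictTotalDegree (Fin d) F Δ) := Module.finite_of_finite F
  let _ : Fintype (restrictTotalDegree (Fin d) F Δ) := Fintype.ofFinite _
  have hcard : Fintype.card F ^ T ≤ Fintype.card (restrictTotalDegree (Fin d) F Δ) := by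
    have hle : Fintype.card (Fin T) ≤ Fintype.card (Fin d → F) := by simpa using hTd
    obtain ⟨x⟩ := Function.Embedding.nonempty_of_card_le hle
    rw [← card_filter_eval_eq_mul hT x.injective 0]
    refine Nat.le_mul_of_pos_left _ (Finset.card_pos.2 ⟨0, ?_⟩)
    simp
  let R : Q → restrictTotalDegree (Fin d) F Δ → Prop := fun x w => x.1.2 = eval x.1.1 w.1
  have hR : ∀ u : Fin s → Q, Function.Injective u →
      (Finset.univ.filter fun w => ∀ a, R (u a) w).card * Fintype.card F ^ s ≤
        Fintype.card (restrictTotalDegree (Fin d) F Δ) := by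
    intro u hu
    by_cases hx : Function.Injective fun a => (u a).1.1
    · rw [← card_filter_eval_eq_mul hs hx fun a => (u a).1.2]
      simp only [R, eq_comm]
      exact le_rfl
      -- A graph contains at most one point above each `x`.
    · rw [Finset.filter_eq_empty_iff.2, Finset.card_empty, zero_mul]
      · exact Nat.zero_le _
      · intro w _ hw
        refine hx fun a b hab => hu (Subtype.ext (Prod.ext hab ?_))
        rw [show (u a).1.2 = _ from hw a, show (u b).1.2 = _ from hw b]
        exact congrArg (fun z => eval z w.1) hab
  obtain ⟨g, hg, hgR⟩ := exists_injective_family_without_biclique R (n := n)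
    (pow_pos Fintype.card_pos s) hR (h₁.trans hcard)
    (by rw [Fintype.card_coe, ← pow_mul]; exact h₂)
  refine ⟨fun i => (g i).1, fun i j h => hg (Subtype.ext h),
    fun i => (mem_restrictTotalDegree _ _ _).1 (g i).2, fun u hu huQ v hv huv => ?_⟩
  exact hgR (fun a => ⟨u a, huQ a⟩) (fun a b h => hu (congrArg Subtype.val h)) v hv huv

/-! ### The choice of the prime -/

/-- For `m` large, a prime `p` of order `m^{1/(d+1)}` makes all the counting conditions hold. -/
lemma exists_prime_parameters {d : ℕ} (hd : 1 ≤ d) {α : ℝ} (hα : 0 < α) {s : ℕ}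
    (hs : s = ⌈(1 + α) * ((d : ℝ) + 1)⌉₊) {m n : ℕ} (hm : (s + 10) ^ (d + 1) ≤ m)
    (hn : n = ⌊(m : ℝ) ^ α⌋₊) :
    ∃ p : ℕ, p.Prime ∧ m ≤ p ^ (d + 1) ∧ 4 * (m ^ s * n ^ s) ≤ p ^ (s * s) ∧
      4 * (n * n) ≤ p ^ (2 * s) ∧ 2 * s ≤ p ^ d ∧ 2 * s ≤ s ^ 2 ∧
      1 / 20 * (m : ℝ) ^ ((d : ℝ) / ((d : ℝ) + 1)) ≤ ((m / p : ℕ) : ℝ) := by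
  have hd1 : (1 : ℝ) ≤ d := by exact_mod_cast hd
  have hsr : (1 + α) * ((d : ℝ) + 1) ≤ s := hs ▸ Nat.le_ceil _
  have hs3 : 3 ≤ s := by
    have : (2 : ℝ) < s := by nlinarith
    exact_mod_cast this
  have hm0 : (0 : ℝ) ≤ m := Nat.cast_nonneg m
  set x : ℝ := (m : ℝ) ^ (1 / ((d : ℝ) + 1)) with hx
  have hxpow : x ^ (d + 1) = m := by
    rw [hx, ← Real.rpow_natCast, ← Real.rpow_mul hm0]
    push_cast
    rw [one_div_mul_cancel (by positivity), Real.rpow_one]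
  have hx0 : 0 ≤ x := Real.rpow_nonneg hm0 _
  have hxs : (s : ℝ) + 10 ≤ x := by
    refine le_of_pow_le_pow_left₀ (Nat.succ_ne_zero d) hx0 ?_
    rw [hxpow]
    exact_mod_cast hm
  have hx10 : 10 ≤ x := by
    have : (0 : ℝ) ≤ s := Nat.cast_nonneg s
    linarith
  -- The factor `4` produces the factors `4` in the counting conditions; Bertrand's postulate costs
  -- another factor `2`, and rounding is absorbed in `p ≤ 10 x`.
  have hk0 : ⌈4 * x⌉₊ ≠ 0 := (Nat.ceil_pos.2 (by linarith)).ne'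
  obtain ⟨p, hp, hkp, hpk⟩ := Nat.exists_prime_lt_and_le_two_mul ⌈4 * x⌉₊ hk0
  have hp4 : 4 * x ≤ p := (Nat.le_ceil _).trans (by exact_mod_cast hkp.le)
  have hp10 : (p : ℝ) ≤ 10 * x := by
    have h1 : (p : ℝ) ≤ 2 * (⌈4 * x⌉₊ : ℝ) := by exact_mod_cast hpk
    have h2 := (Nat.ceil_lt_add_one (show 0 ≤ 4 * x by linarith)).le
    linarith
  have hxp : x ≤ p := by linarith
  have hp0 : (0 : ℝ) < p := by linarith
  have hm1 : 1 ≤ m := le_trans (Nat.one_le_pow _ _ (by omega)) hm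
  have hm1' : (1 : ℝ) ≤ m := by exact_mod_cast hm1
  have hmx : (m : ℝ) = x ^ ((d : ℝ) + 1) := by
    rw [← hxpow, ← Real.rpow_natCast]
    push_cast
    rfl
  have hnr : (n : ℝ) ≤ (m : ℝ) ^ α := hn ▸ Nat.floor_le (Real.rpow_nonneg hm0 _)
  have hn0 : (0 : ℝ) ≤ n := Nat.cast_nonneg n
  have hmn : (m : ℝ) * n ≤ x ^ s := by
    calc (m : ℝ) * n ≤ m * (m : ℝ) ^ α := mul_le_mul_of_nonneg_left hnr hm0
      _ = (m : ℝ) ^ (1 + α) := by rw [Real.rpow_add (by linarith), Real.rpow_one]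
      _ = x ^ ((1 + α) * ((d : ℝ) + 1)) := by rw [hmx, ← Real.rpow_mul hx0, mul_comm]
      _ ≤ x ^ (s : ℝ) := Real.rpow_le_rpow_of_exponent_le (by linarith) hsr
      _ = x ^ s := Real.rpow_natCast _ _
  have hnx : (n : ℝ) ≤ x ^ s := le_trans (by nlinarith) hmn
  have hpow : ∀ k : ℕ, k ≠ 0 → 4 * x ^ k ≤ (p : ℝ) ^ k := by
    intro k hk
    calc 4 * x ^ k ≤ 4 ^ k * x ^ k :=
          mul_le_mul_of_nonneg_right (le_self_pow₀ (by norm_num) hk) (by positivity)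
      _ = (4 * x) ^ k := (mul_pow _ _ _).symm
      _ ≤ (p : ℝ) ^ k := pow_le_pow_left₀ (by linarith) hp4 k
  refine ⟨p, hp, ?_, ?_, ?_, ?_, by nlinarith, ?_⟩
  · have : (m : ℝ) ≤ (p : ℝ) ^ (d + 1) := hxpow ▸ pow_le_pow_left₀ hx0 hxp _
    exact_mod_cast this
  · have : 4 * ((m : ℝ) ^ s * (n : ℝ) ^ s) ≤ (p : ℝ) ^ (s * s) := by
      refine le_trans ?_ (hpow (s * s) (by positivity))
      rw [← mul_pow, pow_mul]
      have := pow_le_pow_left₀ (by positivity) hmn s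
      linarith
    exact_mod_cast this
  · have : 4 * ((n : ℝ) * n) ≤ (p : ℝ) ^ (2 * s) := by
      refine le_trans ?_ (hpow (2 * s) (by positivity))
      rw [two_mul, pow_add]
      have := mul_le_mul hnx hnx hn0 (by positivity)
      linarith
    exact_mod_cast this
  · have h1 : 2 * s ≤ p := by
      have : (2 : ℝ) * s ≤ p := by linarith
      exact_mod_cast this
    exact h1.trans (Nat.le_self_pow (by omega) p)
  · have hxm : x * (m : ℝ) ^ ((d : ℝ) / ((d : ℝ) + 1)) = m := by
      rw [hx, ← Real.rpow_add (by linarith), ← add_div, add_comm (1 : ℝ), div_self (by positivity),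
        Real.rpow_one]
    have hpm : p ≤ m := by
      have : (p : ℝ) ≤ m := by
        rw [← hxpow]
        calc (p : ℝ) ≤ 10 * x := hp10
          _ ≤ x ^ 2 := by nlinarith
          _ ≤ x ^ (d + 1) := pow_le_pow_right₀ (by linarith) (by omega)
      exact_mod_cast this
    have hdiv : m ≤ 2 * p * (m / p) := by
      have h1 := Nat.div_add_mod m p
      have h2 := Nat.mod_lt m hp.pos
      have h3 : 1 ≤ m / p := Nat.div_pos hpm hp.pos
      nlinarith
    have hdiv' : (m : ℝ) ≤ 2 * p * ((m / p : ℕ) : ℝ) := by exact_mod_cast hdiv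
    have h0 : (0 : ℝ) ≤ ((m / p : ℕ) : ℝ) := Nat.cast_nonneg _
    have hle : x * (m : ℝ) ^ ((d : ℝ) / ((d : ℝ) + 1)) ≤ x * (20 * ((m / p : ℕ) : ℝ)) := by
      rw [hxm]
      nlinarith
    have := le_of_mul_le_mul_left hle (by linarith)
    linarith

/-! ### Incidence graphs -/

/-- A family of incidences enumerated without repetition bounds the number of edges from below. -/
lemma card_le_incidences {F K : Type*} [Field F] [Field K] [Algebra F K] {D : ℕ}
    {Pts : Finset (Fin D → F)} {Vars : Finset (Set (Fin D → K))} {ι : Type*} [Fintype ι]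
    (x : ι → Pts) (V : ι → Vars)
    (hxV : ∀ k, (incidenceGraph Pts Vars).Adj (.inl (x k)) (.inr (V k)))
    (hinj : ∀ k l, x k = x l → V k = V l → k = l) :
    Fintype.card ι ≤ incidences Pts Vars := by
  let e : ι → Sym2 (Pts ⊕ Vars) := fun k => s(.inl (x k), .inr (V k))
  have he : Function.Injective e := by
    intro k l h
    simp only [e, Sym2.eq_iff] at h
    rcases h with ⟨h1, h2⟩ | ⟨h1, h2⟩
    · exact hinj k l (Sum.inl_injective h1) (Sum.inr_injective h2)
    · cases h1
  have h1 : (Set.range e).ncard = Fintype.card ι := by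
    rw [← Set.image_univ, Set.ncard_image_of_injective _ he, Set.ncard_univ,
      Nat.card_eq_fintype_card]
  rw [← h1]
  refine Set.ncard_le_ncard ?_ (Set.toFinite _)
  rintro _ ⟨k, rfl⟩
  exact hxV k

/-- In a copy of `K_{s,s}` one side consists of points and the other of varieties. -/
lemma free_of_forall_not {F K : Type*} [Field F] [Field K] [Algebra F K] {D s : ℕ} (hs : 0 < s)
    {Pts : Finset (Fin D → F)} {Vars : Finset (Set (Fin D → K))}
    (h : ∀ u : Fin s → Pts, Function.Injective u → ∀ v : Fin s → Vars, Function.Injective v →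
      ¬ ∀ a b, (fun i => algebraMap F K ((u a).1 i)) ∈ (v b).1) :
    (completeBipartiteGraph (Fin s) (Fin s)).Free (incidenceGraph Pts Vars) := by
  have key : ∀ U V : Fin s → Pts ⊕ Vars, Function.Injective U → Function.Injective V →
      (∀ a b, (incidenceGraph Pts Vars).Adj (U a) (V b)) → ∀ x, U ⟨0, hs⟩ ≠ Sum.inl x := by
    intro U V hU hV hUV x hx
    have hVr : ∀ b, ∃ v, V b = Sum.inr v := by
      intro b
      have hb := hUV ⟨0, hs⟩ b
      rw [hx] at hb
      cases hv : V b with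
      | inl y => rw [hv] at hb; exact hb.elim
      | inr v => exact ⟨v, rfl⟩
    choose v hv using hVr
    have hUl : ∀ a, ∃ u, U a = Sum.inl u := by
      intro a
      have ha := hUV a ⟨0, hs⟩
      rw [hv] at ha
      cases hu : U a with
      | inl y => exact ⟨y, rfl⟩
      | inr w => rw [hu] at ha; exact ha.elim
    choose u hu using hUl
    refine h u (fun a b hab => hU ?_) v (fun a b hab => hV ?_) fun a b => ?_
    · rw [hu, hu, hab]
    · rw [hv, hv, hab]
    · have hab := hUV a b
      rw [hu, hv] at hab
      exact hab
  rintro ⟨φ, hφ⟩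
  have hadj : ∀ a b, (incidenceGraph Pts Vars).Adj (φ (.inl a)) (φ (.inr b)) := fun a b =>
    φ.map_rel (by simp)
  have hl : Function.Injective fun a => φ (.inl a) := fun a b hab => Sum.inl_injective (hφ hab)
  have hr : Function.Injective fun a => φ (.inr a) := fun a b hab => Sum.inr_injective (hφ hab)
  cases h0 : φ (.inl ⟨0, hs⟩) with
  | inl x => exact key _ _ hl hr hadj x h0
  | inr W =>
    cases h1 : φ (.inr ⟨0, hs⟩) with
    | inl x => exact key _ _ hr hl (fun a b => (hadj b a).symm) x h1
    | inr W' =>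
      have := hadj ⟨0, hs⟩ ⟨0, hs⟩
      rw [h0, h1] at this
      exact this

end PointVariety

open PointVariety

theorem theorem2 (d : ℕ) (hd : 1 ≤ d) (α : ℝ) (hα : 0 < α) :
    ∃ c : ℝ, 0 < c ∧ ∀ D : ℕ, d < D → ∃ N : ℕ, ∀ m n : ℕ, N ≤ m → N ≤ n →
      n = ⌊(m : ℝ) ^ α⌋₊ →
      ∀ s Δ : ℕ, s = ⌈(1 + α) * ((d : ℝ) + 1)⌉₊ → Δ = s ^ 2 →
      ∃ (p : ℕ) (_ : Fact p.Prime)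
        (Pts : Finset (Fin D → ZMod p)) (Vars : Finset (Set (Fin D → AlgebraicClosure (ZMod p)))),
        Pts.card = m ∧ Vars.card = n ∧
        (∀ V ∈ Vars, PointVariety.IsVariety V ∧ PointVariety.IsAlgebraicSet (ZMod p) V ∧
          PointVariety.HasDimension V d ∧ ∃ e : ℕ, PointVariety.HasDegree V e ∧ e ≤ Δ) ∧
        (completeBipartiteGraph (Fin s) (Fin s)).Free (PointVariety.incidenceGraph Pts Vars) ∧
        c * (m : ℝ) ^ ((d : ℝ) / ((d : ℝ) + 1)) * (n : ℝ) ≤ (PointVariety.incidences Pts Vars : ℝ) := by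
  refine ⟨1 / 20, by norm_num, fun D hD =>
    ⟨(⌈(1 + α) * ((d : ℝ) + 1)⌉₊ + 10) ^ (d + 1), fun m n hm _ hn s Δ hs hΔ => ?_⟩⟩
  rw [← hs] at hm
  obtain ⟨p, hp, hmp, hK, hinj, hpd, hs2, hbound⟩ := exists_prime_parameters hd hα hs hm hn
  have hs0 : 0 < s := hs ▸ Nat.ceil_pos.2 (by positivity)
  have : Fact p.Prime := ⟨hp⟩
  classical
  let K := AlgebraicClosure (ZMod p)
  have hFcard : Fintype.card (ZMod p) = p := ZMod.card p
  -- The points contain a full product `A × F_p`, so that every graph meets them above all of `A`.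
  obtain ⟨A, -, hA⟩ := Finset.exists_subset_card_eq
    (s := (Finset.univ : Finset (Fin d → ZMod p))) (n := m / p) (by
      rw [Finset.card_univ, Fintype.card_fun, Fintype.card_fin, hFcard]
      exact Nat.div_le_of_le_mul (by rwa [pow_succ'] at hmp))
  obtain ⟨Q, hAQ, -, hQ⟩ := Finset.exists_subsuperset_card_eq
    (Finset.subset_univ (A ×ˢ (Finset.univ : Finset (ZMod p)))) (n := m)
    (by
      rw [Finset.card_product, hA, Finset.card_univ, hFcard]
      exact Nat.div_mul_le_self m p)
    (by
      rw [Finset.card_univ, Fintype.card_prod, Fintype.card_fun, Fintype.card_fin, hFcard]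
      rwa [pow_succ] at hmp)
  obtain ⟨g, hg, hgΔ, hgK⟩ := exists_polynomials_without_biclique (n := n) (Δ := Δ) (T := 2 * s)
    (s := s) Q (by nlinarith) (by omega) (by rwa [hFcard]) (by rwa [hFcard])
    (by rwa [hFcard, hQ])
  let toPt : (Fin d → ZMod p) × ZMod p → Fin D → ZMod p := fun z => pad D z.1 z.2
  have htoPt : Function.Injective toPt := fun z z' h =>
    Prod.ext (pad_injective hD h).1 (pad_injective hD h).2
  let V : Fin n → Set (Fin D → K) := fun i => graphVariety D (map (algebraMap (ZMod p) K) (g i))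
  have hV : Function.Injective V := fun i j h =>
    hg (map_injective _ (algebraMap (ZMod p) K).injective (graphVariety_injective hD h))
  have hmem : ∀ z i, (fun k => algebraMap (ZMod p) K (toPt z k)) ∈ V i ↔ z.2 = eval z.1 (g i) :=
    fun z i => algebraMap_pad_mem_graphVariety hD (g i) z.1 z.2
  refine ⟨p, ⟨hp⟩, Q.image toPt, Finset.univ.image V, ?_, ?_, ?_, ?_, ?_⟩
  · rw [Finset.card_image_of_injective _ htoPt, hQ]
  · rw [Finset.card_image_of_injective _ hV, Finset.card_univ, Fintype.card_fin]
  · intro W hW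
    obtain ⟨i, -, rfl⟩ := Finset.mem_image.1 hW
    refine ⟨isVariety_graphVariety hD _, isAlgebraicSet_graphVariety hD _,
      hasDimension_graphVariety hD _, _, hasDegree_graphVariety hD _, ?_⟩
    exact totalDegree_graphPoly_le _ (by nlinarith) ((totalDegree_map_le _ _).trans (hgΔ i))
  · refine free_of_forall_not hs0 fun u hu v hv huv => ?_
    have hu' : ∀ a, ∃ z ∈ Q, toPt z = (u a).1 := fun a =>
      Finset.mem_image.1 (u a).2
    have hv' : ∀ b, ∃ i, V i = (v b).1 := fun b => by
      obtain ⟨i, -, hi⟩ := Finset.mem_image.1 (v b).2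
      exact ⟨i, hi⟩
    choose z hzQ hz using hu'
    choose w hw using hv'
    refine hgK z (fun a b hab => hu (Subtype.ext ?_)) hzQ w
      (fun a b hab => hv (Subtype.ext ?_)) fun a b => ?_
    · rw [← hz, ← hz, hab]
    · rw [← hw, ← hw, hab]
    · rw [← hmem, hz, hw]
      exact huv a b
  · have hz : ∀ k : A × Fin n, (k.1.1, eval k.1.1 (g k.2)) ∈ Q := fun k =>
      hAQ (Finset.mem_product.2 ⟨k.1.2, Finset.mem_univ _⟩)
    have hcount := card_le_incidences (ι := A × Fin n) (Pts := Q.image toPt)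
      (Vars := Finset.univ.image V)
      (fun k => ⟨toPt (k.1.1, eval k.1.1 (g k.2)), Finset.mem_image_of_mem _ (hz k)⟩)
      (fun k => ⟨V k.2, Finset.mem_image_of_mem _ (Finset.mem_univ _)⟩)
      (fun k => (hmem _ _).2 rfl)
      (fun k l h1 h2 => Prod.ext
        (Subtype.ext (congrArg Prod.fst (htoPt (congrArg Subtype.val h1))))
        (hV (congrArg Subtype.val h2)))
    rw [Fintype.card_prod, Fintype.card_coe, Fintype.card_fin, hA] at hcount
    calc _ ≤ ((m / p : ℕ) : ℝ) * n := mul_le_mul_of_nonneg_right hbound (Nat.cast_nonneg n)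
      _ ≤ _ := by exact_mod_cast hcount
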